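/- Let $\mathbb F$ be a field and let $n,\delta,s,\mu\ge 0$ be integers. Consider the polynomials $C\in\mathbb F[\mathbf x]$ in $n$ variables $\mathbf x$ that are computed by a width-$2$ sparse-factor ROABP, i.e. for which there are an integer $d\ge 0$, a partition $\mathbf x=\mathbf x_0\sqcup\mathbf x_1\sqcup\dots\sqcup\mathbf x_{d+1}$ (blocks may be empty), vectors $D_0\in\mathbb F^2[\mathbf x_0]$ and $D_{d+1}\in\mathbb F^2[\mathbf x_{d+1}]$, and matrices $D_i\in\mathbb F^{2\times 2}[\mathbf x_i]$ for $1\le i\le d$, not assumed to be invertible, with $$C(\mathbf x)=D_0(\mathbf x_0)^{\top}\Big(\prod_{i=1}^{d}D_i(\mathbf x_i)\Big)D_{d+1}(\mathbf x_{d+1}).$$ View each $D_i$ as a polynomial with vector or matrix coefficients, and let $\mathcal C(n,\delta,s,\mu)$ be the class of those $C$ for which the $D_i$ can be chosen so that, for all $0\le i\le d+1$: every variable has degree at most $\delta$ in $D_i$ (this holds in particular if $D_i$ has total degree at most $\delta$), at most $s$ monomials have a nonzero coefficient in $D_i$, and each of these monomials contains at most $\mu$ distinct variables. Let $$\ell:=1+2\min\{\lceil\log_2(4s)\rceil,\mu\}$$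 (with $\ell:=1$ if $s=0$). Theorem. There is a polynomial $p$ with coefficients in $\mathbb N$, independent of $\mathbb F,n,\delta,s,\mu$, such that the following holds for every field extension $\mathbb K/\mathbb F$ (for instance $\mathbb K=\mathbb F$) that is infinite or has at least $p((n\delta s)^{\ell})$ elements: there is a set $\mathcal H\subseteq\mathbb K^n$ of at most $p((n\delta s)^{\ell})$ points such that every nonzero $C\in\mathcal C(n,\delta,s,\mu)$ satisfies $C(a)\ne 0$ for some $a\in\mathcal H$. In other words, $\mathcal C(n,\delta,s,\mu)$ has a hitting set of size $\operatorname{poly}((n\delta s)^{\ell})$, which depends neither on the partition of the variables nor on the factors $D_i$. -/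

import Mathlib

noncomputable section

namespace ROABP

/-- The monomials (exponent vectors) of a polynomial `P = (P k)_k` whose coefficients are vectors
(or matrices, when `ι` is a product), given by its entries: a monomial has a nonzero
vector coefficient iff its coefficient in some entry is nonzero. -/
def monomials {F ι σ : Type*} [CommSemiring F] [Fintype ι] [DecidableEq σ]
    (P : ι → MvPolynomial σ F) : Finset (σ →₀ ℕ) :=
  Finset.univ.biUnion fun k => (P k).support

/-- The bounds imposed on one factor: every variable has degree at most `δ` in it, it has
at most `s` monomials, and each of its monomials contains at most `μ` variables. -/
structure FactorBounds {F ι σ : Type*} [CommSemiring F] [Fintype ι] [DecidableEq σ]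
    (P : ι → MvPolynomial σ F) (δ s μ : ℕ) : Prop where
  degree_le : ∀ m ∈ monomials P, ∀ i, m i ≤ δ
  sparsity_le : (monomials P).card ≤ s
  support_le : ∀ m ∈ monomials P, m.support.card ≤ μ

/-- A width-`w` sparse-factor ROABP over `F` in the variables `x_0, …, x_{n-1}`, with a left
vector `D_0`, a right vector `D_{d+1}` and `d` square matrices between them. The variable `x_i`
belongs to the block `block i`, so the blocks are pairwise disjoint and partition the variables;
the `j`-th factor only involves variables of the `j`-th block. -/
structure SparseFactorROABP (F : Type*) [CommSemiring F] (w n d : ℕ) where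
  block : Fin n → Fin (d + 2)
  left : Fin w → MvPolynomial (Fin n) F
  mid : Fin d → Matrix (Fin w) (Fin w) (MvPolynomial (Fin n) F)
  right : Fin w → MvPolynomial (Fin n) F
  left_vars : ∀ k, ∀ i ∈ (left k).vars, block i = 0
  mid_vars : ∀ j k l, ∀ i ∈ (mid j k l).vars, block i = j.succ.castSucc
  right_vars : ∀ k, ∀ i ∈ (right k).vars, block i = Fin.last (d + 1)

namespace SparseFactorROABP

variable {F : Type*} [CommSemiring F] {w n d : ℕ}

/-- The polynomial `D_0ᵀ (D_1 D_2 ⋯ D_d) D_{d+1}` computed by the ROABP. -/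
def poly (A : SparseFactorROABP F w n d) : MvPolynomial (Fin n) F :=
  A.left ⬝ᵥ Matrix.mulVec (List.ofFn A.mid).prod A.right

/-- All factors `D_0, …, D_{d+1}` obey the bounds `δ`, `s`, `μ`. -/
structure Bounded (A : SparseFactorROABP F w n d) (δ s μ : ℕ) : Prop where
  left : FactorBounds A.left δ s μ
  mid : ∀ j, FactorBounds (fun kl : Fin w × Fin w => A.mid j kl.1 kl.2) δ s μ
  right : FactorBounds A.right δ s μ

end SparseFactorROABP

/-- The class of `n`-variate polynomials over `F` computed by width-`w` sparse-factor ROABPs, with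
any number of factors and any assignment of the variables to the factors, all of whose factors
obey the bounds `δ`, `s`, `μ`. -/
def polyClass (F : Type*) [CommSemiring F] (w n δ s μ : ℕ) : Set (MvPolynomial (Fin n) F) :=
  {C | ∃ (d : ℕ) (A : SparseFactorROABP F w n d), A.Bounded δ s μ ∧ A.poly = C}

/-- `H ⊆ Kⁿ` is a hitting set for a class `𝒞` of polynomials with coefficients in `F ⊆ K`. -/
def IsHittingSet {F K : Type*} [CommSemiring F] [CommSemiring K] [Algebra F K] {n : ℕ}
    (𝒞 : Set (MvPolynomial (Fin n) F)) (H : Set (Fin n → K)) : Prop :=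
  ∀ P ∈ 𝒞, P ≠ 0 → ∃ a ∈ H, MvPolynomial.aeval a P ≠ 0

/-- `ℓ = 1 + 2 · min {⌈log₂ (4 s)⌉, μ}`. -/
def ell (s μ : ℕ) : ℕ := 1 + 2 * min ⌈Real.logb 2 (4 * s)⌉₊ μ

end ROABP

end

/-! Write m = min {c, μ} with s ≤ 2^c. Over an infinite field, suppose first that no middle factor
has zero determinant. Choose a point α with nonzero coordinates at which all these determinants are
nonzero, and γ with C(γ) ≠ 0. Two vectors orthogonal to a nonzero vector of a plane are
proportional, so some nonzero value of the product arises with every middle factor but at most one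
taken at α (`dotProduct_prod_mulVec_ne_zero`). The at most three factors still taken at γ can each
be moved to within m coordinates of α, since a sparse polynomial has a monomial isolated by m
variables. So C is nonzero within 3m coordinates of α.

A factor of zero determinant has rank one, and up to a nonzero multiplier C splits there into two
shorter programs (`pathPoly_mul_of_det_eq_zero`).

A polynomial map G with k seed pairs reaches every point with at most k coordinates different from
1. It reaches a suitable α with 2m pairs and the altered point with 3m more. Nonvanishing under G
passes to products, so splitting costs no seeds. Hence C ∘ G ≠ 0 for k = 5m, and a grid of seeds
larger than its degree in each direction gives the hitting set. -/

namespace ROABP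

open MvPolynomial

open scoped Pointwise

/-! ### Monomials isolated by few variables -/

section Isolation

variable {σ : Type*} [DecidableEq σ]

/-- Among at most `2 ^ c` monomials, some monomial is determined by its exponents at at most `c`
variables. -/
theorem exists_isolating_of_card_le (c : ℕ) (M : Finset (σ →₀ ℕ)) (hM : M.Nonempty)
    (hc : M.card ≤ 2 ^ c) :
    ∃ S : Finset σ, S.card ≤ c ∧ ∃ m ∈ M, ∀ m' ∈ M, (∀ i ∈ S, m' i = m i) → m' = m := by
  induction c generalizing M with
  | zero =>
    obtain ⟨m, hm⟩ := hM
    exact ⟨∅, by simp, m, hm, fun m' hm' _ =>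
      Finset.card_le_one.mp (by simpa using hc) m' hm' m hm⟩
  | succ c ih =>
    by_cases hsub : ∀ m₁ ∈ M, ∀ m₂ ∈ M, m₁ = m₂
    · obtain ⟨m, hm⟩ := hM
      exact ⟨∅, by simp, m, hm, fun m' hm' _ => hsub m' hm' m hm⟩
    push Not at hsub
    obtain ⟨m₁, h₁, m₂, h₂, hne⟩ := hsub
    obtain ⟨i, hi⟩ : ∃ i, m₁ i ≠ m₂ i := by
      by_contra! h
      exact hne (Finsupp.ext h)
    -- The fibres of the exponent of `i` through `m₁` and `m₂` are disjoint, so one of them has at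
    -- most half of the monomials.
    have key : ∃ e, (M.filter fun m => m i = e).Nonempty ∧
        (M.filter fun m => m i = e).card ≤ 2 ^ c := by
      by_contra! h
      have a₁ := h (m₁ i) ⟨m₁, by simp [h₁]⟩
      have a₂ := h (m₂ i) ⟨m₂, by simp [h₂]⟩
      have hdisj : Disjoint (M.filter fun m => m i = m₁ i) (M.filter fun m => m i = m₂ i) := by
        rw [Finset.disjoint_filter]
        intro m _ e₁ e₂
        exact hi (e₁.symm.trans e₂)
      have := Finset.card_le_card (Finset.union_subset (Finset.filter_subset _ _)
        (Finset.filter_subset _ _) :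
        (M.filter fun m => m i = m₁ i) ∪ (M.filter fun m => m i = m₂ i) ⊆ M)
      rw [Finset.card_union_of_disjoint hdisj] at this
      rw [pow_succ] at hc
      omega
    obtain ⟨e, hne', hcard⟩ := key
    obtain ⟨S, hS, m, hm, hiso⟩ := ih _ hne' hcard
    rw [Finset.mem_filter] at hm
    refine ⟨insert i S, (Finset.card_insert_le _ _).trans (by omega), m, hm.1, ?_⟩
    intro m' hm' hag
    refine hiso m' (Finset.mem_filter.mpr ⟨hm', ?_⟩) fun j hj => hag j (Finset.mem_insert_of_mem hj)
    rw [hag i (Finset.mem_insert_self _ _), hm.2]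

/-- Among monomials with at most `μ` variables, some monomial is determined by its exponents at
at most `μ` variables. -/
theorem exists_isolating_of_support_le (μ : ℕ) (M : Finset (σ →₀ ℕ)) (hM : M.Nonempty)
    (hμ : ∀ m ∈ M, m.support.card ≤ μ) :
    ∃ S : Finset σ, S.card ≤ μ ∧ ∃ m ∈ M, ∀ m' ∈ M, (∀ i ∈ S, m' i = m i) → m' = m := by
  -- A monomial that agrees with `m` on the support of `m` is a multiple of `m`; maximal degree then
  -- forces equality.
  obtain ⟨m, hm, hmax⟩ := Finset.exists_max_image M Finsupp.degree hM
  refine ⟨m.support, hμ m hm, m, hm, fun m' hm' hag => ?_⟩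
  have hle : m ≤ m' := by
    intro i
    by_cases hi : i ∈ m.support
    · exact (hag i hi).ge
    · simp [Finsupp.notMem_support_iff.mp hi]
  obtain ⟨r, rfl⟩ := exists_add_of_le hle
  have := hmax _ hm'
  rw [map_add] at this
  have hr : r = 0 := (Finsupp.degree_eq_zero_iff r).mp (by omega)
  simp [hr]

theorem exists_isolating (c μ : ℕ) (M : Finset (σ →₀ ℕ)) (hM : M.Nonempty)
    (hc : M.card ≤ 2 ^ c) (hμ : ∀ m ∈ M, m.support.card ≤ μ) :
    ∃ S : Finset σ, S.card ≤ min c μ ∧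
      ∃ m ∈ M, ∀ m' ∈ M, (∀ i ∈ S, m' i = m i) → m' = m := by
  rcases le_total c μ with h | h
  · rw [min_eq_left h]
    exact exists_isolating_of_card_le c M hM hc
  · rw [min_eq_right h]
    exact exists_isolating_of_support_le μ M hM hμ

end Isolation

/-! ### Nonzero values near a given point -/

section Evaluation

variable {L : Type*} [Field L] [Infinite L] {σ : Type*} [Fintype σ] [DecidableEq σ]

/-- If a monomial of `f` is determined by its exponents at `S`, then `f` does not vanish
identically on the points that agree outside `S` with a given point without zero coordinates. -/
theorem exists_eval_ne_zero_of_isolating (f : MvPolynomial σ L) (α : σ → L) (hα : ∀ i, α i ≠ 0)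
    (S : Finset σ) (m : σ →₀ ℕ) (hm : m ∈ f.support)
    (hiso : ∀ m' ∈ f.support, (∀ i ∈ S, m' i = m i) → m' = m) :
    ∃ β : σ → L, (∀ i ∉ S, β i = α i) ∧ eval β f ≠ 0 := by
  -- `g` is `f` with the variables outside `S` set to `α`. Only `m` contributes to the coefficient
  -- of its restriction to `S`, so nothing cancels there.
  set g : MvPolynomial σ L := ∑ m' ∈ f.support,
    monomial (m'.filter (· ∈ S)) (coeff m' f * ∏ i ∈ Sᶜ, α i ^ m' i) with hg
  have hcoeff : coeff (m.filter (· ∈ S)) g = coeff m f * ∏ i ∈ Sᶜ, α i ^ m i := by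
    rw [hg, coeff_sum, Finset.sum_eq_single m]
    · simp
    · intro m' hm' hne
      rw [coeff_monomial, if_neg]
      intro heq
      refine hne (hiso m' hm' fun i hi => ?_)
      simpa [Finsupp.filter_apply, hi] using DFunLike.congr_fun heq i
    · exact fun h => absurd hm h
  have hg0 : g ≠ 0 := by
    intro h
    rw [h, coeff_zero] at hcoeff
    exact mul_ne_zero (mem_support_iff.mp hm)
      (Finset.prod_ne_zero_iff.mpr fun i _ => pow_ne_zero _ (hα i)) hcoeff.symm
  obtain ⟨γ, hγ⟩ : ∃ γ, eval γ g ≠ 0 := by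
    by_contra! h
    exact hg0 (MvPolynomial.funext fun x => by simp [h x])
  refine ⟨fun i => if i ∈ S then γ i else α i, fun i hi => if_neg hi, ?_⟩
  convert hγ using 1
  rw [hg, map_sum, eval_eq']
  refine Finset.sum_congr rfl fun m' _ => ?_
  rw [eval_monomial, Finsupp.prod_fintype _ _ (by simp), mul_assoc]
  congr 1
  rw [← Finset.prod_mul_prod_compl S, mul_comm,
    ← Finset.prod_mul_prod_compl S fun i => γ i ^ (m'.filter (· ∈ S)) i]
  have h₁ : ∏ i ∈ Sᶜ, γ i ^ (m'.filter (· ∈ S)) i = 1 :=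
    Finset.prod_eq_one fun i hi => by simp [Finset.mem_compl.mp hi]
  rw [h₁, mul_one]
  congr 1
  · exact Finset.prod_congr rfl fun i hi => by simp [Finset.mem_compl.mp hi]
  · exact Finset.prod_congr rfl fun i hi => by simp [hi]

theorem exists_eval_ne_zero (f : MvPolynomial σ L) (hf : f ≠ 0) (α : σ → L) (hα : ∀ i, α i ≠ 0)
    (c μ : ℕ) (hc : f.support.card ≤ 2 ^ c) (hμ : ∀ m ∈ f.support, m.support.card ≤ μ) :
    ∃ S : Finset σ, S.card ≤ min c μ ∧
      ∃ β : σ → L, (∀ i ∉ S, β i = α i) ∧ eval β f ≠ 0 := by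
  obtain ⟨S, hS, m, hm, hiso⟩ := exists_isolating c μ f.support (support_nonempty.mpr hf) hc hμ
  exact ⟨S, hS, exists_eval_ne_zero_of_isolating f α hα S m hm hiso⟩

/-- A linear functional of a sparse vector of polynomials that is nonzero somewhere is nonzero at a
point that differs from `α` in few coordinates. -/
theorem FactorBounds.exists_linear_ne_zero {ι : Type*} [Fintype ι] {P : ι → MvPolynomial σ L}
    {δ s μ c : ℕ} (hP : FactorBounds P δ s μ) (hs : s ≤ 2 ^ c) (α : σ → L) (hα : ∀ i, α i ≠ 0)
    (w : ι → L) (γ : σ → L) (hγ : ∑ k, eval γ (P k) * w k ≠ 0) :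
    ∃ S : Finset σ, S.card ≤ min c μ ∧
      ∃ β : σ → L, (∀ i ∉ S, β i = α i) ∧ ∑ k, eval β (P k) * w k ≠ 0 := by
  set f : MvPolynomial σ L := ∑ k, C (w k) * P k with hfdef
  have heval : ∀ x, eval x f = ∑ k, eval x (P k) * w k := fun x => by simp [hfdef, mul_comm]
  have hsub : f.support ⊆ monomials P := by
    refine support_sum.trans fun m hm => ?_
    simp only [Finset.mem_biUnion, Finset.mem_univ, true_and] at hm
    obtain ⟨k, hk⟩ := hm
    simp only [monomials, Finset.mem_biUnion, Finset.mem_univ, true_and]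
    refine ⟨k, ?_⟩
    rw [mem_support_iff, coeff_C_mul] at hk
    exact mem_support_iff.mpr (right_ne_zero_of_mul hk)
  have hf : f ≠ 0 := by
    rintro h
    rw [← heval, h] at hγ
    simp at hγ
  obtain ⟨S, hS, β, hβ, hne⟩ := exists_eval_ne_zero f hf α hα c μ
    ((Finset.card_le_card hsub).trans (hP.sparsity_le.trans hs))
    fun m hm => hP.support_le m (hsub hm)
  exact ⟨S, hS, β, hβ, by rwa [← heval]⟩

end Evaluation

/-! ### Products of invertible 2 × 2 matrices -/

section LinearAlgebra

variable {L : Type*} [Field L]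

theorem exists_eq_smul_of_dotProduct_eq_zero (u w w' : Fin 2 → L) (hu : u ≠ 0) (hw : w ≠ 0)
    (h : u ⬝ᵥ w = 0) (h' : u ⬝ᵥ w' = 0) : ∃ c : L, w' = c • w := by
  simp only [dotProduct, Fin.sum_univ_two] at h h'
  have hdet : w 0 * w' 1 = w 1 * w' 0 := by
    by_cases h0 : u 0 = 0
    · have h1 : u 1 ≠ 0 := fun h1 => hu (by ext i; fin_cases i <;> simp [h0, h1])
      apply mul_left_cancel₀ h1
      linear_combination w 0 * h' - w' 0 * h
    · apply mul_left_cancel₀ h0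
      linear_combination w' 1 * h - w 1 * h'
  by_cases h0 : w 0 = 0
  · have h1 : w 1 ≠ 0 := fun h1 => hw (by ext i; fin_cases i <;> simp [h0, h1])
    refine ⟨w' 1 / w 1, ?_⟩
    have : w' 0 = 0 := by
      rw [h0, zero_mul, eq_comm] at hdet
      exact (mul_eq_zero.mp hdet).resolve_left h1
    ext i
    fin_cases i
    · simp [h0, this]
    · simp [h1]
  · refine ⟨w' 0 / w 0, ?_⟩
    ext i
    fin_cases i
    · simp [h0]
    · simp only [Fin.mk_one, Pi.smul_apply, smul_eq_mul]
      field_simp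
      linear_combination hdet

open Matrix

/-- If `uᵀ A₁ ⋯ A_d v` vanishes, and still vanishes after replacing any one invertible `A_j` by
`B_j`, then `B₁ ⋯ B_d v` is a multiple of `A₁ ⋯ A_d v`. -/
theorem exists_prod_mulVec_eq_smul
    (l : List (Matrix (Fin 2) (Fin 2) L × Matrix (Fin 2) (Fin 2) L)) (u v : Fin 2 → L)
    (hu : u ≠ 0) (hv : v ≠ 0) (hdet : ∀ p ∈ l, p.1.det ≠ 0)
    (h0 : u ⬝ᵥ ((l.map Prod.fst).prod *ᵥ v) = 0)
    (h1 : ∀ l₁ p l₂, l = l₁ ++ p :: l₂ →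
      u ⬝ᵥ ((l₁.map Prod.fst).prod *ᵥ (p.2 *ᵥ ((l₂.map Prod.fst).prod *ᵥ v))) = 0) :
    ∃ c : L, (l.map Prod.snd).prod *ᵥ v = c • ((l.map Prod.fst).prod *ᵥ v) := by
  induction l generalizing u with
  | nil => exact ⟨1, by simp⟩
  | cons p l ih =>
    have hp : p.1.det ≠ 0 := hdet p (by simp)
    have hu' : u ᵥ* p.1 ≠ 0 := fun h => hp (exists_vecMul_eq_zero_iff.mp ⟨u, hu, h⟩)
    obtain ⟨c, hc⟩ := ih (u ᵥ* p.1) hu' (fun q hq => hdet q (by simp [hq]))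
      (by
        rw [← dotProduct_mulVec, mulVec_mulVec]
        simpa using h0)
      (fun l₁ q l₂ hl => by
        rw [← dotProduct_mulVec, mulVec_mulVec]
        simpa using h1 (p :: l₁) q l₂ (by simp [hl]))
    have hlist : (l.map Prod.fst).prod.det ≠ 0 := by
      have : ∀ l' : List (Matrix (Fin 2) (Fin 2) L × Matrix (Fin 2) (Fin 2) L),
          (∀ q ∈ l', q.1.det ≠ 0) → (l'.map Prod.fst).prod.det ≠ 0 := by
        intro l' hl'
        induction l' with
        | nil => simp
        | cons q l' ih' =>
          simp only [List.map_cons, List.prod_cons, det_mul]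
          exact mul_ne_zero (hl' q (by simp)) (ih' fun r hr => hl' r (by simp [hr]))
      exact this l fun q hq => hdet q (by simp [hq])
    have hw : ((p :: l).map Prod.fst).prod *ᵥ v ≠ 0 := fun h => by
      have := exists_mulVec_eq_zero_iff.mp ⟨v, hv, h⟩
      simp only [List.map_cons, List.prod_cons, det_mul, mul_eq_zero] at this
      exact this.elim hp hlist
    -- By induction the tails of the two products applied to `v` are proportional, so only the head
    -- remains to be exchanged. Both heads give vectors orthogonal to `u`, and the one from the
    -- invertible head is nonzero.
    obtain ⟨c', hc'⟩ := exists_eq_smul_of_dotProduct_eq_zero u _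
      (p.2 *ᵥ ((l.map Prod.fst).prod *ᵥ v)) hu hw h0 (by simpa using h1 [] p l rfl)
    refine ⟨c * c', ?_⟩
    simp only [List.map_cons, List.prod_cons] at hc' ⊢
    rw [← mulVec_mulVec, hc, mulVec_smul, hc', smul_smul]

/-- Otherwise the product of the second components sends `v` to a multiple of a vector that `u`
annihilates. In use, the first components are values at `α` and the second ones values at `γ`. -/
theorem dotProduct_prod_mulVec_ne_zero
    (l : List (Matrix (Fin 2) (Fin 2) L × Matrix (Fin 2) (Fin 2) L)) (u v : Fin 2 → L)
    (hdet : ∀ p ∈ l, p.1.det ≠ 0) (h : u ⬝ᵥ ((l.map Prod.snd).prod *ᵥ v) ≠ 0) :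
    u ⬝ᵥ ((l.map Prod.fst).prod *ᵥ v) ≠ 0 ∨ ∃ l₁ p l₂, l = l₁ ++ p :: l₂ ∧
      u ⬝ᵥ ((l₁.map Prod.fst).prod *ᵥ (p.2 *ᵥ ((l₂.map Prod.fst).prod *ᵥ v))) ≠ 0 := by
  by_contra! hcon
  have hu : u ≠ 0 := by
    rintro rfl
    simp at h
  have hv : v ≠ 0 := by
    rintro rfl
    simp at h
  obtain ⟨c, hc⟩ := exists_prod_mulVec_eq_smul l u v hu hv hdet hcon.1
    fun l₁ p l₂ hl => hcon.2 l₁ p l₂ hl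
  rw [hc, dotProduct_smul, hcon.1, smul_zero] at h
  exact h rfl

end LinearAlgebra

/-! ### The generator and the points it reaches -/

section Generator

variable {K : Type*} [Field K] {n : ℕ}

/-- The point with coordinates `1 + ∑ j, Lᵢ(y_j) z_j`, where `L₀, …, L_{n-1}` is the Lagrange basis
at the nodes `a`. -/
noncomputable def generatorPoint (a : Fin n → K) {A ι : Type*} [CommRing A] [Algebra K A]
    [Fintype ι] (y z : ι → A) (i : Fin n) : A :=
  1 + ∑ j, Polynomial.aeval (y j) (Lagrange.basis Finset.univ a i) * z j

theorem map_generatorPoint (a : Fin n → K) {A B ι : Type*} [CommRing A] [Algebra K A]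
    [CommRing B] [Algebra K B] [Fintype ι] (φ : A →ₐ[K] B) (y z : ι → A) (i : Fin n) :
    φ (generatorPoint a y z i) = generatorPoint a (φ ∘ y) (φ ∘ z) i := by
  simp [generatorPoint, Polynomial.aeval_algHom_apply]

variable {L : Type*} [Field L] [Algebra K L]

/-- The points over `L` that the generator reaches with `k` pairs of seeds. -/
def IsReachable (a : Fin n → K) (k : ℕ) (x : Fin n → L) : Prop :=
  ∃ y z : Fin k → L, x = generatorPoint a y z

theorem isReachable_one (a : Fin n → K) (k : ℕ) :
    IsReachable a k (1 : Fin n → L) :=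
  ⟨0, 0, by ext i; simp [generatorPoint]⟩

theorem IsReachable.succ {a : Fin n → K} {k : ℕ} {x : Fin n → L} (h : IsReachable a k x) :
    IsReachable a (k + 1) x := by
  obtain ⟨y, z, rfl⟩ := h
  refine ⟨Fin.snoc y 0, Fin.snoc z 0, ?_⟩
  ext i
  simp [generatorPoint, Fin.sum_univ_castSucc]

theorem IsReachable.mono {a : Fin n → K} {k k' : ℕ} (hk : k ≤ k') {x : Fin n → L}
    (h : IsReachable a k x) : IsReachable a k' x := by
  induction hk with
  | refl => exact h
  | step _ ih => exact ih.succ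

/-- At the node `a i` the Lagrange basis is the indicator of `i`, so one new seed pair shifts this
coordinate alone, by any amount. -/
theorem IsReachable.update {a : Fin n → K} (ha : Function.Injective a) {k : ℕ} {x : Fin n → L}
    (h : IsReachable a k x) (i : Fin n) (t : L) :
    IsReachable a (k + 1) (Function.update x i t) := by
  obtain ⟨y, z, rfl⟩ := h
  refine ⟨Fin.snoc y (algebraMap K L (a i)),
    Fin.snoc z (t - generatorPoint a y z i), ?_⟩
  ext j
  have hsplit : generatorPoint a (Fin.snoc y (algebraMap K L (a i)) : Fin (k + 1) → L)
      (Fin.snoc z (t - generatorPoint a y z i) : Fin (k + 1) → L) j = generatorPoint a y z j +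
      Polynomial.aeval (algebraMap K L (a i)) (Lagrange.basis Finset.univ a j) *
        (t - generatorPoint a y z i) := by
    rw [generatorPoint, Fin.sum_univ_castSucc, ← add_assoc]
    simp [generatorPoint]
  rw [hsplit, Polynomial.aeval_algebraMap_apply, Polynomial.coe_aeval_eq_eval]
  by_cases hij : j = i
  · subst hij
    rw [Lagrange.eval_basis_self ha.injOn (Finset.mem_univ _)]
    simp
  · rw [Lagrange.eval_basis_of_ne hij (Finset.mem_univ _)]
    simp [hij]

theorem IsReachable.of_eq_off {a : Fin n → K} (ha : Function.Injective a) {k : ℕ}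
    {x x' : Fin n → L} (h : IsReachable a k x) (S : Finset (Fin n))
    (hS : ∀ i ∉ S, x' i = x i) : IsReachable a (k + S.card) x' := by
  induction S using Finset.induction_on generalizing x' with
  | empty =>
    obtain rfl : x' = x := funext fun i => hS i (by simp)
    simpa using h
  | insert i S hi ih =>
    have h' := (ih (x' := Function.update x' i (x i)) fun j hj => by
      by_cases hji : j = i
      · subst hji
        simp
      · rw [Function.update_of_ne hji]
        exact hS j (by simp [hji, hj])).update ha i (x' i)
    rw [Function.update_idem, Function.update_eq_self] at h'
    rwa [Finset.card_insert_of_notMem hi, ← add_assoc]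

/-- `P` does not vanish identically on the points that are reachable with `k` pairs of seeds. -/
def IsHit (a : Fin n → K) (k : ℕ) (P : MvPolynomial (Fin n) L) : Prop :=
  ∃ x, IsReachable a k x ∧ eval x P ≠ 0

variable (L) in
/-- The generator with indeterminate seeds. -/
noncomputable def generator (a : Fin n → K) (k : ℕ) : Fin n → MvPolynomial (Fin k ⊕ Fin k) L :=
  generatorPoint a (fun j => X (Sum.inl j)) fun j => X (Sum.inr j)

theorem aeval_aeval_generator (a : Fin n → K) {k : ℕ} {M : Type*} [Field M] [Algebra K M]
    [Algebra M L] [IsScalarTower K M L] (y z : Fin k → L) (P : MvPolynomial (Fin n) M) :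
    aeval (Sum.elim y z) (aeval (generator M a k) P) = aeval (generatorPoint a y z) P := by
  have hcomp : (aeval (Sum.elim y z)).comp (aeval (generator M a k)) =
      aeval (R := M) (generatorPoint a y z) := by
    ext i
    have := map_generatorPoint a ((aeval (Sum.elim y z)).restrictScalars K :
      MvPolynomial (Fin k ⊕ Fin k) M →ₐ[K] L) (fun j => X (Sum.inl j)) (fun j => X (Sum.inr j)) i
    rw [AlgHom.restrictScalars_apply] at this
    rw [AlgHom.comp_apply, aeval_X, aeval_X, generator, this]
    congr 2 <;> ext j <;> simp
  exact DFunLike.congr_fun hcomp P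

theorem eval_aeval_generator (a : Fin n → K) {k : ℕ} (y z : Fin k → L)
    (P : MvPolynomial (Fin n) L) :
    eval (Sum.elim y z) (aeval (generator L a k) P) = eval (generatorPoint a y z) P :=
  aeval_aeval_generator a y z P

/-- Polynomial rings over fields are domains, so in this form being hit is stable under products
with the same `k`. -/
theorem isHit_iff_aeval_generator_ne_zero [Infinite L] (a : Fin n → K) (k : ℕ)
    (P : MvPolynomial (Fin n) L) : IsHit a k P ↔ aeval (generator L a k) P ≠ 0 := by
  constructor
  · rintro ⟨_, ⟨y, z, rfl⟩, hne⟩ h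
    rw [← eval_aeval_generator, h, map_zero] at hne
    exact hne rfl
  · intro h
    obtain ⟨w, hw⟩ : ∃ w, eval w (aeval (generator L a k) P) ≠ 0 := by
      by_contra! h'
      exact h (MvPolynomial.funext fun w => by rw [h' w, map_zero])
    refine ⟨_, ⟨w ∘ Sum.inl, w ∘ Sum.inr, rfl⟩, ?_⟩
    rwa [← eval_aeval_generator, Sum.elim_comp_inl_inr]

theorem IsHit.prod [Infinite L] {a : Fin n → K} {k : ℕ} {T : Type*} (s : Finset T)
    {P : T → MvPolynomial (Fin n) L} (h : ∀ t ∈ s, IsHit a k (P t)) :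
    IsHit a k (∏ t ∈ s, P t) := by
  rw [isHit_iff_aeval_generator_ne_zero, map_prod, Finset.prod_ne_zero_iff]
  exact fun t ht => (isHit_iff_aeval_generator_ne_zero a k _).mp (h t ht)

theorem IsHit.mul [Infinite L] {a : Fin n → K} {k : ℕ} {P Q : MvPolynomial (Fin n) L}
    (hP : IsHit a k P) (hQ : IsHit a k Q) : IsHit a k (P * Q) := by
  rw [isHit_iff_aeval_generator_ne_zero] at *
  rw [map_mul]
  exact mul_ne_zero hP hQ

theorem IsHit.of_mul_left {a : Fin n → K} {k : ℕ} {P Q : MvPolynomial (Fin n) L}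
    (h : IsHit a k (P * Q)) : IsHit a k Q := by
  obtain ⟨x, hx, hne⟩ := h
  rw [map_mul] at hne
  exact ⟨x, hx, right_ne_zero_of_mul hne⟩

/-- A nonzero polynomial with few monomials, or whose monomials contain few variables, is hit. -/
theorem isHit_of_sparse [Infinite L] {a : Fin n → K} (ha : Function.Injective a)
    (P : MvPolynomial (Fin n) L) (hP : P ≠ 0) (c μ : ℕ) (hc : P.support.card ≤ 2 ^ c)
    (hμ : ∀ m ∈ P.support, m.support.card ≤ μ) : IsHit a (min c μ) P := by
  obtain ⟨S, hS, β, hβ, hne⟩ := exists_eval_ne_zero P hP 1 (by simp) c μ hc hμ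
  refine ⟨β, ?_, hne⟩
  exact ((isReachable_one a 0).of_eq_off ha S hβ).mono (by simpa using hS)

/-- Monomials of the determinant are products of two monomials of `D`: both the logarithm of their
number and their variable count at most double. -/
theorem isHit_det [Infinite L] {a : Fin n → K} (ha : Function.Injective a)
    (D : Matrix (Fin 2) (Fin 2) (MvPolynomial (Fin n) L)) (hD : D.det ≠ 0) {δ s μ c : ℕ}
    (hb : FactorBounds (fun kl : Fin 2 × Fin 2 => D kl.1 kl.2) δ s μ) (hs : s ≤ 2 ^ c) :
    IsHit a (2 * min c μ) D.det := by
  set M := monomials fun kl : Fin 2 × Fin 2 => D kl.1 kl.2 with hM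
  have hentry : ∀ k l, (D k l).support ⊆ M := fun k l =>
    Finset.subset_biUnion_of_mem (fun kl : Fin 2 × Fin 2 => (D kl.1 kl.2).support)
      (Finset.mem_univ (k, l))
  have hprod : ∀ k l k' l', (D k l * D k' l').support ⊆ M + M := fun k l k' l' =>
    (support_mul _ _).trans (Finset.add_subset_add (hentry k l) (hentry k' l'))
  have hsub : D.det.support ⊆ M + M := by
    rw [Matrix.det_fin_two]
    exact (support_sub _ _ _).trans (Finset.union_subset (hprod _ _ _ _) (hprod _ _ _ _))
  rw [← Nat.mul_min_mul_left]
  refine isHit_of_sparse ha _ hD _ _ ?_ ?_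
  · calc D.det.support.card ≤ (M + M).card := Finset.card_le_card hsub
      _ ≤ M.card * M.card := Finset.card_add_le
      _ ≤ 2 ^ c * 2 ^ c := Nat.mul_le_mul (hb.sparsity_le.trans hs) (hb.sparsity_le.trans hs)
      _ = 2 ^ (2 * c) := by rw [← pow_add, two_mul]
  · intro m hm
    obtain ⟨m₁, h₁, m₂, h₂, rfl⟩ := Finset.mem_add.mp (hsub hm)
    have := (Finset.card_le_card Finsupp.support_add).trans
      (Finset.card_union_le m₁.support m₂.support)
    have := hb.support_le m₁ h₁
    have := hb.support_le m₂ h₂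
    omega

end Generator

/-! ### Nonvanishing of width-2 programs -/

section Paths

open Matrix

variable {B : Type*} {n : ℕ}

/-- The polynomial `uᵀ D₁ ⋯ D_d v` of a list of labelled matrices. -/
noncomputable def pathPoly {F : Type*} [CommSemiring F] (u : Fin 2 → MvPolynomial (Fin n) F)
    (l : List (B × Matrix (Fin 2) (Fin 2) (MvPolynomial (Fin n) F)))
    (v : Fin 2 → MvPolynomial (Fin n) F) : MvPolynomial (Fin n) F :=
  u ⬝ᵥ ((l.map Prod.snd).prod *ᵥ v)

/-- The factors `u`, `l`, `v` use the variables of pairwise different blocks, and obey the bounds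
`δ`, `s`, `μ`. -/
structure IsReadOnce {F : Type*} [CommSemiring F] (block : Fin n → B) (δ s μ : ℕ) (b₀ : B)
    (u : Fin 2 → MvPolynomial (Fin n) F)
    (l : List (B × Matrix (Fin 2) (Fin 2) (MvPolynomial (Fin n) F))) (b₁ : B)
    (v : Fin 2 → MvPolynomial (Fin n) F) : Prop where
  nodup : (b₀ :: b₁ :: l.map Prod.fst).Nodup
  left_vars : ∀ k, ∀ i ∈ (u k).vars, block i = b₀
  mid_vars : ∀ p ∈ l, ∀ k k', ∀ i ∈ (p.2 k k').vars, block i = p.1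
  right_vars : ∀ k, ∀ i ∈ (v k).vars, block i = b₁
  left : FactorBounds u δ s μ
  mid : ∀ p ∈ l, FactorBounds (fun kl : Fin 2 × Fin 2 => p.2 kl.1 kl.2) δ s μ
  right : FactorBounds v δ s μ

theorem FactorBounds.of_monomials_subset {F F' ι ι' σ : Type*} [CommSemiring F] [CommSemiring F']
    [Fintype ι] [Fintype ι'] [DecidableEq σ] {P : ι → MvPolynomial σ F} {δ s μ : ℕ}
    (h : FactorBounds P δ s μ) {Q : ι' → MvPolynomial σ F'} (hsub : monomials Q ⊆ monomials P) :
    FactorBounds Q δ s μ :=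
  ⟨fun m hm => h.degree_le m (hsub hm), (Finset.card_le_card hsub).trans h.sparsity_le,
    fun m hm => h.support_le m (hsub hm)⟩

theorem FactorBounds.comp {F ι ι' σ : Type*} [CommSemiring F] [Fintype ι] [Fintype ι']
    [DecidableEq σ] {P : ι → MvPolynomial σ F} {δ s μ : ℕ} (h : FactorBounds P δ s μ)
    (g : ι' → ι) : FactorBounds (P ∘ g) δ s μ :=
  h.of_monomials_subset <| Finset.biUnion_subset.mpr fun k _ =>
    Finset.subset_biUnion_of_mem (fun k => (P k).support) (Finset.mem_univ (g k))

theorem FactorBounds.map {F F' ι σ : Type*} [CommSemiring F] [CommSemiring F'] [Fintype ι]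
    [DecidableEq σ] {P : ι → MvPolynomial σ F} {δ s μ : ℕ} (h : FactorBounds P δ s μ)
    (φ : F →+* F') : FactorBounds (fun k => MvPolynomial.map φ (P k)) δ s μ :=
  h.of_monomials_subset <| Finset.biUnion_mono fun _ _ => support_map_subset _ _

variable {L : Type*} [Field L]

theorem eval_pathPoly (x : Fin n → L) (u : Fin 2 → MvPolynomial (Fin n) L)
    (l : List (B × Matrix (Fin 2) (Fin 2) (MvPolynomial (Fin n) L)))
    (v : Fin 2 → MvPolynomial (Fin n) L) :
    eval x (pathPoly u l v) = (fun k => eval x (u k)) ⬝ᵥ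
      ((l.map fun p => p.2.map (eval x)).prod *ᵥ fun k => eval x (v k)) := by
  have h : ((l.map Prod.snd).prod).map (eval x) = (l.map fun p => p.2.map (eval x)).prod := by
    have := map_list_prod ((eval x).mapMatrix (m := Fin 2)) (l.map Prod.snd)
    rw [List.map_map] at this
    exact this
  rw [pathPoly, RingHom.map_dotProduct, ← h]
  congr 1
  ext k
  exact RingHom.map_mulVec _ _ _ _

theorem eval_eq_of_vars {x x' : Fin n → L} {P : MvPolynomial (Fin n) L}
    (h : ∀ i ∈ P.vars, x i = x' i) : eval x P = eval x' P :=
  eval₂Hom_congr' rfl (fun i hi _ => h i hi) rfl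

theorem det_eval (x : Fin n → L) (D : Matrix (Fin 2) (Fin 2) (MvPolynomial (Fin n) L)) :
    (D.map (eval x)).det = eval x D.det :=
  ((eval x).map_det D).symm

/-- Makes a middle factor accessible to `FactorBounds.exists_linear_ne_zero`, which needs a linear
functional of its entries. -/
theorem sum_mul_mul_eq_dotProduct_mulVec (D : Matrix (Fin 2) (Fin 2) L) (r t : Fin 2 → L) :
    ∑ kl : Fin 2 × Fin 2, D kl.1 kl.2 * (r kl.1 * t kl.2) = r ⬝ᵥ (D *ᵥ t) := by
  simp only [Fintype.sum_prod_type, dotProduct, mulVec, Fin.sum_univ_two]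
  ring

/-- Vanishing determinant means that the `(k, k')` entry times the matrix equals column `k'` times
row `k`, which cuts the path in two. -/
theorem pathPoly_mul_of_det_eq_zero (u v : Fin 2 → MvPolynomial (Fin n) L)
    (l₁ l₂ : List (B × Matrix (Fin 2) (Fin 2) (MvPolynomial (Fin n) L)))
    (p : B × Matrix (Fin 2) (Fin 2) (MvPolynomial (Fin n) L)) (hp : p.2.det = 0) (k k' : Fin 2) :
    p.2 k k' * pathPoly u (l₁ ++ p :: l₂) v =
      pathPoly u l₁ (fun i => p.2 i k') * pathPoly (fun i => p.2 k i) l₂ v := by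
  have hrank : ∀ t : Fin 2 → MvPolynomial (Fin n) L,
      p.2 k k' • (p.2 *ᵥ t) = (p.2 k ⬝ᵥ t) • fun i => p.2 i k' := by
    intro t
    rw [det_fin_two] at hp
    ext i : 1
    simp only [Pi.smul_apply, mulVec, dotProduct, Fin.sum_univ_two, smul_eq_mul]
    fin_cases i <;> fin_cases k <;> fin_cases k' <;> simp only [Fin.zero_eta, Fin.mk_one] <;>
      first
      | ring1
      | linear_combination t 0 * hp
      | linear_combination t 1 * hp
      | linear_combination -t 0 * hp
      | linear_combination -t 1 * hp
  simp only [pathPoly, List.map_append, List.map_cons, List.prod_append, List.prod_cons]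
  rw [← mulVec_mulVec, ← mulVec_mulVec, ← smul_eq_mul, ← dotProduct_smul, ← mulVec_smul, hrank,
    mulVec_smul, dotProduct_smul, smul_eq_mul, mul_comm]

variable [Infinite L] [DecidableEq B]

/-- If all middle factors are invertible at `α`, then a nonzero path polynomial is nonzero at a
point that differs from `α` in few coordinates. -/
theorem IsReadOnce.exists_eval_ne_zero {block : Fin n → B} {δ s μ c : ℕ} {b₀ b₁ : B}
    {u v : Fin 2 → MvPolynomial (Fin n) L}
    {l : List (B × Matrix (Fin 2) (Fin 2) (MvPolynomial (Fin n) L))}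
    (h : IsReadOnce block δ s μ b₀ u l b₁ v) (hs : s ≤ 2 ^ c) (α : Fin n → L)
    (hα : ∀ i, α i ≠ 0) (hdet : ∀ p ∈ l, eval α p.2.det ≠ 0) (hne : pathPoly u l v ≠ 0) :
    ∃ S : Finset (Fin n), S.card ≤ 3 * min c μ ∧
      ∃ β : Fin n → L, (∀ i ∉ S, β i = α i) ∧ eval β (pathPoly u l v) ≠ 0 := by
  obtain ⟨γ, hγ⟩ : ∃ γ, eval γ (pathPoly u l v) ≠ 0 := by
    by_contra! h'
    exact hne (MvPolynomial.funext fun x => by rw [h' x, map_zero])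
  rw [eval_pathPoly] at hγ
  set l' := l.map fun p => (p.2.map (eval α), p.2.map (eval γ)) with hl'
  have hfst : l'.map Prod.fst = l.map fun p => p.2.map (eval α) := by simp [hl']
  have hsnd : l'.map Prod.snd = l.map fun p => p.2.map (eval γ) := by simp [hl']
  have hnd := h.nodup
  rw [List.nodup_cons, List.nodup_cons, List.mem_cons, not_or] at hnd
  obtain ⟨⟨hb, hb₀⟩, hb₁, hnd⟩ := hnd
  have hb₀' : ∀ p ∈ l, p.1 ≠ b₀ := fun p hp he => hb₀ (he ▸ List.mem_map_of_mem hp)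
  have hb₁' : ∀ p ∈ l, p.1 ≠ b₁ := fun p hp he => hb₁ (he ▸ List.mem_map_of_mem hp)
  rcases dotProduct_prod_mulVec_ne_zero l' _ _
      (by
        intro q hq
        obtain ⟨p, hp, rfl⟩ := List.mem_map.mp hq
        simpa only [det_eval] using hdet p hp) (by rwa [hsnd]) with h₀ | ⟨l₁', p', l₂', heq, h₀⟩
  · rw [hfst] at h₀
    obtain ⟨S₀, hS₀, β₀, hβ₀, h₁⟩ := h.left.exists_linear_ne_zero hs α hα _ γ h₀
    change (fun k => eval β₀ (u k)) ⬝ᵥ _ ≠ 0 at h₁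
    rw [dotProduct_mulVec, dotProduct_comm] at h₁
    obtain ⟨S₁, hS₁, β₁, hβ₁, h₂⟩ := h.right.exists_linear_ne_zero hs α hα _ γ h₁
    change (fun k => eval β₁ (v k)) ⬝ᵥ _ ≠ 0 at h₂
    rw [dotProduct_comm, ← dotProduct_mulVec] at h₂
    -- Each factor reads only its own block, so the separately chosen points glue together.
    set β : Fin n → L := fun i => if block i = b₀ then β₀ i else
      if block i = b₁ then β₁ i else α i with hβ
    refine ⟨S₀ ∪ S₁, (Finset.card_union_le _ _).trans (by omega), β, ?_, ?_⟩
    · intro i hi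
      simp only [Finset.mem_union, not_or] at hi
      simp [hβ, hβ₀ i hi.1, hβ₁ i hi.2]
    · have hu : (fun k => eval β (u k)) = fun k => eval β₀ (u k) :=
        funext fun k => eval_eq_of_vars fun i hi => by simp [hβ, h.left_vars k i hi]
      have hv : (fun k => eval β (v k)) = fun k => eval β₁ (v k) :=
        funext fun k => eval_eq_of_vars fun i hi => by
          simp [hβ, h.right_vars k i hi, Ne.symm hb]
      have hl : ∀ p ∈ l, p.2.map (eval β) = p.2.map (eval α) := fun p hp => by
        ext k k' : 1
        exact eval_eq_of_vars fun i hi => by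
          simp [hβ, h.mid_vars p hp k k' i hi, hb₀' p hp, hb₁' p hp]
      rwa [eval_pathPoly, hu, hv, List.map_congr_left hl]
  · obtain ⟨l₁, l₂'', rfl, rfl, heq₂⟩ := List.map_eq_append_iff.mp heq
    obtain ⟨p, l₂, rfl, rfl, rfl⟩ := List.map_eq_cons_iff.mp heq₂
    simp only [List.map_map, Function.comp_def] at h₀
    have hp : p ∈ l₁ ++ p :: l₂ := by simp
    obtain ⟨S₀, hS₀, β₀, hβ₀, h₁⟩ := h.left.exists_linear_ne_zero hs α hα _ γ h₀
    change (fun k => eval β₀ (u k)) ⬝ᵥ _ ≠ 0 at h₁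
    rw [dotProduct_mulVec, ← sum_mul_mul_eq_dotProduct_mulVec] at h₁
    obtain ⟨S₂, hS₂, β₂, hβ₂, h₂⟩ := (h.mid p hp).exists_linear_ne_zero hs α hα _ γ h₁
    change ∑ kl : Fin 2 × Fin 2, (p.2.map (eval β₂)) kl.1 kl.2 * _ ≠ 0 at h₂
    rw [sum_mul_mul_eq_dotProduct_mulVec, dotProduct_mulVec, dotProduct_mulVec,
      dotProduct_comm] at h₂
    obtain ⟨S₁, hS₁, β₁, hβ₁, h₃⟩ := h.right.exists_linear_ne_zero hs α hα _ γ h₂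
    change (fun k => eval β₁ (v k)) ⬝ᵥ _ ≠ 0 at h₃
    rw [dotProduct_comm, ← dotProduct_mulVec, ← dotProduct_mulVec, ← dotProduct_mulVec] at h₃
    have hlab : ∀ q ∈ l₁ ++ l₂, q.1 ≠ p.1 := by
      rw [List.map_append, List.map_cons, List.nodup_middle, List.nodup_cons,
        ← List.map_append] at hnd
      exact fun q hq he => hnd.1 (he ▸ List.mem_map_of_mem hq)
    set β : Fin n → L := fun i => if block i = b₀ then β₀ i else
      if block i = b₁ then β₁ i else if block i = p.1 then β₂ i else α i with hβ
    refine ⟨S₀ ∪ (S₂ ∪ S₁), (Finset.card_union_le _ _).trans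
      ((Nat.add_le_add_left (Finset.card_union_le _ _) _).trans (by omega)), β, ?_, ?_⟩
    · intro i hi
      simp only [Finset.mem_union, not_or] at hi
      simp [hβ, hβ₀ i hi.1, hβ₁ i hi.2.2, hβ₂ i hi.2.1]
    · have hu : (fun k => eval β (u k)) = fun k => eval β₀ (u k) :=
        funext fun k => eval_eq_of_vars fun i hi => by simp [hβ, h.left_vars k i hi]
      have hv : (fun k => eval β (v k)) = fun k => eval β₁ (v k) :=
        funext fun k => eval_eq_of_vars fun i hi => by
          simp [hβ, h.right_vars k i hi, Ne.symm hb]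
      have hpβ : p.2.map (eval β) = p.2.map (eval β₂) := by
        ext k k' : 1
        exact eval_eq_of_vars fun i hi => by
          simp [hβ, h.mid_vars p hp k k' i hi, hb₀' p hp, hb₁' p hp]
      have hl : ∀ q ∈ l₁ ++ l₂, q.2.map (eval β) = q.2.map (eval α) := fun q hq => by
        have hq' : q ∈ l₁ ++ p :: l₂ := by
          simp only [List.mem_append, List.mem_cons] at hq ⊢
          tauto
        ext k k' : 1
        exact eval_eq_of_vars fun i hi => by
          simp [hβ, h.mid_vars q hq' k k' i hi, hb₀' q hq', hb₁' q hq', hlab q hq]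
      rwa [eval_pathPoly, List.map_append, List.map_cons, List.prod_append, List.prod_cons,
        ← mulVec_mulVec, ← mulVec_mulVec, hu, hv, hpβ,
        List.map_congr_left fun q hq => hl q (List.mem_append_left _ hq),
        List.map_congr_left fun q hq => hl q (List.mem_append_right _ hq)]

variable {K : Type*} [Field K] [Algebra K L]

theorem IsReadOnce.isHit_of_det_ne_zero {a : Fin n → K} (ha : Function.Injective a)
    {block : Fin n → B} {δ s μ c : ℕ} {b₀ b₁ : B} {u v : Fin 2 → MvPolynomial (Fin n) L}
    {l : List (B × Matrix (Fin 2) (Fin 2) (MvPolynomial (Fin n) L))}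
    (h : IsReadOnce block δ s μ b₀ u l b₁ v) (hs : s ≤ 2 ^ c)
    (hdet : ∀ p ∈ l, p.2.det ≠ 0) (hne : pathPoly u l v ≠ 0) :
    IsHit a (5 * min c μ) (pathPoly u l v) := by
  -- Hitting the product of all variables makes the coordinates of `α` nonzero, as the restriction
  -- to few variables requires.
  have hX : IsHit a (2 * min c μ) (∏ i, X i : MvPolynomial (Fin n) L) :=
    IsHit.prod _ fun i _ => ⟨1, isReachable_one a _, by simp⟩
  have hD : IsHit a (2 * min c μ) (∏ j : Fin l.length, (l.get j).2.det) :=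
    IsHit.prod _ fun j _ => isHit_det ha _ (hdet _ (l.get_mem j)) (h.mid _ (l.get_mem j)) hs
  obtain ⟨α, hα, hαne⟩ := hX.mul hD
  rw [map_mul, map_prod, map_prod, mul_ne_zero_iff, Finset.prod_ne_zero_iff,
    Finset.prod_ne_zero_iff] at hαne
  obtain ⟨S, hS, β, hβ, hβne⟩ := h.exists_eval_ne_zero hs α
    (fun i => by simpa using hαne.1 i (Finset.mem_univ i))
    (fun p hp => by
      obtain ⟨j, rfl⟩ := List.get_of_mem hp
      exact hαne.2 j (Finset.mem_univ j)) hne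
  exact ⟨β, (hα.of_eq_off ha S hβ).mono (by omega), hβne⟩

/-- Induction on the number of middle factors: a singular one is replaced by a column ending the
left path and a row starting the right path, and these inherit its block and bounds. -/
theorem IsReadOnce.isHit {a : Fin n → K} (ha : Function.Injective a)
    {block : Fin n → B} {δ s μ c : ℕ} (hs : s ≤ 2 ^ c) {b₀ b₁ : B}
    {u v : Fin 2 → MvPolynomial (Fin n) L}
    {l : List (B × Matrix (Fin 2) (Fin 2) (MvPolynomial (Fin n) L))}
    (h : IsReadOnce block δ s μ b₀ u l b₁ v) (hne : pathPoly u l v ≠ 0) :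
    IsHit a (5 * min c μ) (pathPoly u l v) := by
  induction hN : l.length using Nat.strong_induction_on generalizing b₀ b₁ u v l with
  | _ N ih =>
  by_cases hdet : ∀ p ∈ l, p.2.det ≠ 0
  · exact h.isHit_of_det_ne_zero ha hs hdet hne
  push Not at hdet
  obtain ⟨p, hp, hp0⟩ := hdet
  obtain ⟨l₁, l₂, rfl⟩ := List.append_of_mem hp
  obtain ⟨k, k', hkk⟩ : ∃ k k', p.2 k k' ≠ 0 := by
    by_contra! h0
    have : p.2 = 0 := by
      ext k k' : 1
      exact h0 k k'
    exact hne (by simp [pathPoly, this])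
  have hmul := pathPoly_mul_of_det_eq_zero u v l₁ l₂ p hp0 k k'
  have hne' := mul_ne_zero hkk hne
  rw [hmul, mul_ne_zero_iff] at hne'
  have hnd := h.nodup
  simp only [List.map_append, List.map_cons, List.nodup_cons, List.mem_cons, List.mem_append,
    List.nodup_append, not_or] at hnd
  have h₁ : IsReadOnce block δ s μ b₀ u l₁ p.1 fun i => p.2 i k' := by
    refine ⟨?_, h.left_vars, fun q hq => h.mid_vars q (by simp [hq]), fun i => h.mid_vars p hp i k',
      h.left, fun q hq => h.mid q (by simp [hq]), (h.mid p hp).comp fun i => (i, k')⟩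
    simp only [List.nodup_cons, List.mem_cons, not_or]
    exact ⟨⟨hnd.1.2.2.1, hnd.1.2.1⟩, fun hmem => hnd.2.2.2.2 _ hmem _ (Or.inl rfl) rfl,
      hnd.2.2.1⟩
  have h₂ : IsReadOnce block δ s μ p.1 (fun i => p.2 k i) l₂ b₁ v := by
    refine ⟨?_, fun i => h.mid_vars p hp k i, fun q hq => h.mid_vars q (by simp [hq]), h.right_vars,
      (h.mid p hp).comp fun i => (k, i), fun q hq => h.mid q (by simp [hq]), h.right⟩
    simp only [List.nodup_cons, List.mem_cons, not_or]
    exact ⟨⟨Ne.symm hnd.2.1.2.1, hnd.2.2.2.1.1⟩, hnd.2.1.2.2, hnd.2.2.2.1.2⟩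
  simp only [List.length_append, List.length_cons] at hN
  have hit₁ := ih l₁.length (by omega) h₁ hne'.1 rfl
  have hit₂ := ih l₂.length (by omega) h₂ hne'.2 rfl
  have hit := hit₁.mul hit₂
  rw [← hmul] at hit
  exact hit.of_mul_left

end Paths

/-! ### Degree bounds -/

section Degree

variable {R : Type*} [CommSemiring R] {σ : Type*}

theorem totalDegree_aeval_le {A τ : Type*} [CommSemiring A] [Algebra R A] [Fintype σ]
    (f : σ → MvPolynomial τ A) (D : ℕ) (hf : ∀ i, (f i).totalDegree ≤ D)
    (P : MvPolynomial σ R) : (aeval f P).totalDegree ≤ P.totalDegree * D := by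
  rw [aeval_def, eval₂_eq']
  refine totalDegree_finsetSum_le fun m hm => ?_
  rw [MvPolynomial.algebraMap_apply]
  refine (totalDegree_mul _ _).trans ?_
  rw [totalDegree_C, zero_add]
  refine (totalDegree_finsetProd _ _).trans ?_
  calc ∑ i, (f i ^ m i).totalDegree ≤ ∑ i, m i * D :=
        Finset.sum_le_sum fun i _ =>
          (totalDegree_pow _ _).trans (Nat.mul_le_mul_left _ (hf i))
    _ = (m.sum fun _ e => e) * D := by rw [← Finset.sum_mul, Finsupp.sum_fintype _ _ (by simp)]
    _ ≤ P.totalDegree * D := Nat.mul_le_mul_right _ (le_totalDegree hm)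

theorem totalDegree_polynomial_aeval_X_le [Nontrivial R] (q : Polynomial R) (j : σ) :
    (Polynomial.aeval (X j : MvPolynomial σ R) q).totalDegree ≤ q.natDegree := by
  rw [Polynomial.aeval_eq_sum_range]
  refine totalDegree_finsetSum_le fun i hi => (totalDegree_smul_le _ _).trans ?_
  exact (totalDegree_X_pow j i).le.trans (by simpa [Nat.lt_succ_iff] using hi)

theorem totalDegree_generator_le {K : Type*} [Field K] {n : ℕ} {a : Fin n → K}
    (ha : Function.Injective a) (k : ℕ) (i : Fin n) : (generator K a k i).totalDegree ≤ n := by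
  rw [generator, generatorPoint]
  refine (totalDegree_add _ _).trans (max_le (by simp) (totalDegree_finsetSum_le fun j _ => ?_))
  refine (totalDegree_mul _ _).trans ?_
  have h₁ := totalDegree_polynomial_aeval_X_le (Lagrange.basis Finset.univ a i)
    (Sum.inl j : Fin k ⊕ Fin k)
  rw [Lagrange.natDegree_basis ha.injOn (Finset.mem_univ i), Finset.card_fin] at h₁
  rw [totalDegree_X]
  have := i.pos
  omega

theorem totalDegree_list_prod_ofFn_le {w d : ℕ}
    (M : Fin d → Matrix (Fin w) (Fin w) (MvPolynomial σ R)) (g : Fin d → ℕ)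
    (h : ∀ j k l, (M j k l).totalDegree ≤ g j) (k l : Fin w) :
    ((List.ofFn M).prod k l).totalDegree ≤ ∑ j, g j := by
  induction d generalizing k with
  | zero =>
    simp only [List.ofFn_zero, List.prod_nil, Matrix.one_apply]
    split_ifs <;> simp
  | succ d ih =>
    rw [List.ofFn_succ, List.prod_cons, Matrix.mul_apply, Fin.sum_univ_succ]
    exact totalDegree_finsetSum_le fun i _ => (totalDegree_mul _ _).trans
      (Nat.add_le_add (h 0 k i) (ih _ _ (fun j => h j.succ) i))

theorem FactorBounds.totalDegree_le {n : ℕ} {B ι : Type*} [DecidableEq B] [Fintype ι]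
    {P : ι → MvPolynomial (Fin n) R} {δ s μ : ℕ} (h : FactorBounds P δ s μ) {block : Fin n → B}
    {b : B} (k : ι) (hb : ∀ i ∈ (P k).vars, block i = b) :
    (P k).totalDegree ≤ (Finset.univ.filter fun i => block i = b).card * δ := by
  refine Finset.sup_le fun m hm => ?_
  have hm' : m ∈ monomials P :=
    Finset.subset_biUnion_of_mem (fun k => (P k).support) (Finset.mem_univ k) hm
  calc m.sum (fun _ e => e) ≤ ∑ i ∈ m.support, δ := Finset.sum_le_sum fun i _ => h.degree_le m hm' i
    _ = m.support.card * δ := by simp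
    _ ≤ _ := Nat.mul_le_mul_right _ (Finset.card_le_card fun i hi => by
        simpa using hb i ((mem_vars_iff_mem_support i).mpr ⟨m, hm, hi⟩))

/-- A factor has degree at most `δ` times the size of its block, and the block sizes add up to `n`,
whatever `d` is. -/
theorem SparseFactorROABP.Bounded.totalDegree_poly_le {w n d δ s μ : ℕ}
    {A : SparseFactorROABP R w n d} (hA : A.Bounded δ s μ) : A.poly.totalDegree ≤ n * δ := by
  set g : Fin (d + 2) → ℕ := fun b => (Finset.univ.filter fun i => A.block i = b).card with hg
  have hsum : n * δ = g 0 * δ + (∑ j : Fin d, g j.succ.castSucc * δ + g (Fin.last (d + 1)) * δ) := by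
    have hn := Finset.card_eq_sum_card_fiberwise (f := A.block) (s := Finset.univ)
      (t := Finset.univ) fun _ _ => Finset.mem_coe.mpr (Finset.mem_univ _)
    rw [Finset.card_fin, Fin.sum_univ_succ, Fin.sum_univ_castSucc] at hn
    rw [← Finset.sum_mul, ← add_mul, ← add_mul]
    congr 1
  rw [hsum, poly, dotProduct]
  refine totalDegree_finsetSum_le fun k _ => (totalDegree_mul _ _).trans
    (Nat.add_le_add (hA.left.totalDegree_le k (A.left_vars k)) ?_)
  rw [Matrix.mulVec, dotProduct]
  refine totalDegree_finsetSum_le fun l _ => (totalDegree_mul _ _).trans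
    (Nat.add_le_add (totalDegree_list_prod_ofFn_le _ _ (fun j k l => ?_) k l)
      (hA.right.totalDegree_le l (A.right_vars l)))
  exact (hA.mid j).totalDegree_le (k, l) (A.mid_vars j k l)

end Degree

/-! ### The hitting set and its size -/

section HittingSet

open Matrix

theorem SparseFactorROABP.map_poly {F L : Type*} [CommSemiring F] [CommSemiring L] {n d : ℕ}
    (A : SparseFactorROABP F 2 n d) (φ : F →+* L) :
    MvPolynomial.map φ A.poly = pathPoly (fun k => MvPolynomial.map φ (A.left k))
      (List.ofFn fun j => (j.succ.castSucc, (A.mid j).map (MvPolynomial.map φ)))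
      fun k => MvPolynomial.map φ (A.right k) := by
  have h : ((List.ofFn A.mid).prod).map (MvPolynomial.map φ) =
      (List.ofFn fun j => (A.mid j).map (MvPolynomial.map φ)).prod := by
    have := map_list_prod ((MvPolynomial.map (σ := Fin n) φ).mapMatrix (m := Fin 2))
      (List.ofFn A.mid)
    rw [List.map_ofFn] at this
    exact this
  rw [poly, pathPoly, RingHom.map_dotProduct, List.map_ofFn]
  change _ = _ ⬝ᵥ ((List.ofFn fun j => (A.mid j).map (MvPolynomial.map φ)).prod *ᵥ _)
  rw [← h]
  congr 1
  ext k : 1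
  exact RingHom.map_mulVec _ _ _ _

theorem SparseFactorROABP.Bounded.isReadOnce {F L : Type*} [CommSemiring F] [CommSemiring L]
    {n d δ s μ : ℕ} {A : SparseFactorROABP F 2 n d} (hA : A.Bounded δ s μ) (φ : F →+* L) :
    IsReadOnce A.block δ s μ 0 (fun k => MvPolynomial.map φ (A.left k))
      (List.ofFn fun j => (j.succ.castSucc, (A.mid j).map (MvPolynomial.map φ)))
      (Fin.last (d + 1)) fun k => MvPolynomial.map φ (A.right k) where
  nodup := by
    rw [List.map_ofFn, List.nodup_cons, List.nodup_cons, List.mem_cons, not_or, List.mem_ofFn,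
      List.mem_ofFn, List.nodup_ofFn]
    refine ⟨⟨(Fin.last_pos).ne, ?_⟩, ?_, ?_⟩
    · rintro ⟨j, hj⟩
      simp [Fin.ext_iff] at hj
    · rintro ⟨j, hj⟩
      have := j.isLt
      simp [Fin.ext_iff] at hj
      omega
    · intro i j hij
      simpa [Fin.ext_iff] using hij
  left_vars k i hi := A.left_vars k i (vars_map _ _ hi)
  mid_vars p hp k k' i hi := by
    obtain ⟨j, rfl⟩ := List.mem_ofFn.mp hp
    exact A.mid_vars j k k' i (vars_map _ _ hi)
  right_vars k i hi := A.right_vars k i (vars_map _ _ hi)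
  left := hA.left.map φ
  mid p hp := by
    obtain ⟨j, rfl⟩ := List.mem_ofFn.mp hp
    exact (hA.mid j).map φ
  right := hA.right.map φ

/-- The generator with `5 min {c, μ}` pairs of seeds preserves the nonzeroness of width-2
sparse-factor ROABPs. -/
theorem aeval_generator_ne_zero {F K : Type*} [Field F] [Field K] [Algebra F K]
    {n δ s μ c : ℕ} {a : Fin n → K} (ha : Function.Injective a) (hs : s ≤ 2 ^ c)
    {P : MvPolynomial (Fin n) F} (hP : P ∈ polyClass F 2 n δ s μ) (hne : P ≠ 0) :
    aeval (generator K a (5 * min c μ)) (MvPolynomial.map (algebraMap F K) P) ≠ 0 := by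
  obtain ⟨d, A, hA, rfl⟩ := hP
  -- `K` may be finite, so the nonvanishing point is sought over its algebraic closure; it still
  -- shows that the composite over `K` is nonzero.
  set φ : F →+* AlgebraicClosure K := (algebraMap K (AlgebraicClosure K)).comp (algebraMap F K)
  have hne' : MvPolynomial.map φ A.poly ≠ 0 := fun h =>
    hne (MvPolynomial.map_injective φ φ.injective (by rw [h, map_zero]))
  rw [A.map_poly φ] at hne'
  obtain ⟨_, ⟨y, z, rfl⟩, hx⟩ := (hA.isReadOnce φ).isHit ha hs hne'
  intro h0
  have h := aeval_aeval_generator a y z (MvPolynomial.map (algebraMap F K) A.poly)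
  rw [h0, map_zero, aeval_def, ← eval_map, MvPolynomial.map_map, A.map_poly] at h
  exact hx h.symm

/-- The composite with the generator has degree at most `n * δ` times `n`, so it is nonzero
somewhere on the grid of seeds from `T`. -/
theorem exists_hittingSet_of_le_card {F K : Type*} [Field F] [Field K] [Algebra F K]
    {n δ s μ c : ℕ} (a : Fin n → K) (ha : Function.Injective a) (hs : s ≤ 2 ^ c)
    (T : Finset K) (hT : n * δ * n < T.card) :
    ∃ H : Finset (Fin n → K), H.card ≤ T.card ^ (2 * (5 * min c μ)) ∧
      IsHittingSet (polyClass F 2 n δ s μ) (H : Set (Fin n → K)) := by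
  classical
  set k := 5 * min c μ with hk
  refine ⟨(Fintype.piFinset fun _ : Fin k ⊕ Fin k => T).image
    fun w => generatorPoint a (w ∘ Sum.inl) (w ∘ Sum.inr), ?_, ?_⟩
  · refine Finset.card_image_le.trans_eq ?_
    simp [Fintype.card_piFinset, two_mul]
  · intro P hP hne
    set Q := aeval (generator K a k) (MvPolynomial.map (algebraMap F K) P) with hQ
    have hQne : Q ≠ 0 := aeval_generator_ne_zero ha hs hP hne
    have hdeg : Q.totalDegree < T.card := by
      refine lt_of_le_of_lt ?_ hT
      refine (totalDegree_aeval_le _ n (totalDegree_generator_le ha k) _).trans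
        (Nat.mul_le_mul_right _ ?_)
      obtain ⟨d, A, hA, rfl⟩ := hP
      exact (Finset.sup_mono (support_map_subset _ _)).trans hA.totalDegree_poly_le
    obtain ⟨w, hw, hwne⟩ : ∃ w : Fin k ⊕ Fin k → K, (∀ i, w i ∈ T) ∧ eval w Q ≠ 0 := by
      by_contra! h
      exact hQne (eq_zero_of_eval_zero_at_prod_finset Q (fun _ => T)
        (fun i => (degreeOf_le_totalDegree Q i).trans_lt hdeg) h)
    refine ⟨_, Finset.mem_coe.mpr
      (Finset.mem_image_of_mem _ (Fintype.mem_piFinset.mpr hw)), ?_⟩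
    rw [← Sum.elim_comp_inl_inr w, hQ, eval_aeval_generator, eval_map] at hwne
    exact hwne

theorem exists_finset_card_eq {K : Type*} {N : ℕ} (h : (N : ℕ∞) ≤ ENat.card K) :
    ∃ T : Finset K, T.card = N := by
  rw [← Set.encard_univ] at h
  obtain ⟨t, -, ht⟩ := Set.exists_subset_encard_eq h
  have hfin : t.Finite := Set.finite_of_encard_eq_coe ht
  refine ⟨hfin.toFinset, ?_⟩
  rw [hfin.encard_eq_coe_toFinset_card] at ht
  exact_mod_cast ht

theorem isHittingSet_singleton_of_mul_eq_zero {F K : Type*} [Field F] [Field K] [Algebra F K]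
    {n δ s μ : ℕ} (h : n * δ * s = 0) :
    IsHittingSet (polyClass F 2 n δ s μ) ({0} : Set (Fin n → K)) := by
  rintro _ ⟨d, A, hA, rfl⟩ hne
  refine ⟨0, rfl, ?_⟩
  rcases mul_eq_zero.mp h with h | h
  · have hdeg := hA.totalDegree_poly_le
    rw [h, Nat.le_zero, totalDegree_eq_zero_iff_eq_C] at hdeg
    rw [hdeg] at hne ⊢
    rw [aeval_C]
    exact (map_ne_zero _).mpr fun h0 => hne (by rw [h0, C_0])
  · refine absurd ?_ hne
    have hmon : monomials A.left = ∅ := by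
      have := hA.left.sparsity_le
      rw [h] at this
      exact Finset.card_eq_zero.mp (Nat.le_zero.mp this)
    have hleft : A.left = 0 := funext fun k => by
      rw [Pi.zero_apply, ← support_eq_empty, ← Finset.subset_empty, ← hmon]
      exact Finset.subset_biUnion_of_mem (fun k => (A.left k).support) (Finset.mem_univ k)
    rw [SparseFactorROABP.poly, hleft, zero_dotProduct]

theorem le_two_pow_ceil_logb (s : ℕ) : s ≤ 2 ^ ⌈Real.logb 2 (4 * s)⌉₊ := by
  rcases Nat.eq_zero_or_pos s with rfl | hs
  · simp
  have hs' : (0 : ℝ) < s := by exact_mod_cast hs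
  have h := (Real.logb_le_iff_le_rpow one_lt_two (by positivity)).mp
    (Nat.le_ceil (Real.logb 2 (4 * s)))
  rw [Real.rpow_natCast] at h
  have : (s : ℝ) ≤ 2 ^ ⌈Real.logb 2 (4 * s)⌉₊ := by linarith
  exact_mod_cast this

theorem ceil_logb_four : ⌈Real.logb 2 (4 * (1 : ℕ))⌉₊ = 2 := by
  have : Real.logb 2 (4 * (1 : ℕ)) = (2 : ℕ) := by
    rw [Real.logb_eq_iff_rpow_eq] <;> norm_num
  rw [this, Nat.ceil_natCast]

theorem hittingSet_size_le {n δ s : ℕ} (μ : ℕ) (hN : n * δ * s ≠ 0) :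
    (n * δ * n + 1) ^ (2 * (5 * min ⌈Real.logb 2 (4 * s)⌉₊ μ)) ≤
      2 ^ 20 * ((n * δ * s) ^ ell s μ) ^ 15 + 1 ∧
    n * δ * n + 1 ≤ 2 ^ 20 * ((n * δ * s) ^ ell s μ) ^ 15 + 1 := by
  set N := n * δ * s with hNdef
  rcases (Nat.one_le_iff_ne_zero.mpr hN).eq_or_lt with h1 | h2
  -- For `N = 1` powers of `N` do not grow; the grid has side 2 and dimension at most 20, whence the
  -- constant `2 ^ 20`.
  · have h1' := h1.symm
    rw [hNdef] at h1'
    obtain ⟨hnδ, rfl⟩ := mul_eq_one.mp h1'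
    obtain ⟨rfl, rfl⟩ := mul_eq_one.mp hnδ
    rw [← h1, one_pow, one_pow, ceil_logb_four]
    refine ⟨?_, by norm_num⟩
    calc (1 * 1 * 1 + 1) ^ (2 * (5 * min 2 μ)) ≤ 2 ^ 20 :=
          Nat.pow_le_pow_right (by norm_num) (by omega)
      _ ≤ _ := by norm_num
  · have hnδ : 0 < n * δ := Nat.pos_of_ne_zero (left_ne_zero_of_mul hN)
    have hs : 0 < s := Nat.pos_of_ne_zero (right_ne_zero_of_mul hN)
    have hδ : 0 < δ := Nat.pos_of_mul_pos_left hnδ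
    have h₁ : n * δ ≤ N := Nat.le_mul_of_pos_right _ hs
    have h₂ : n ≤ N := (Nat.le_mul_of_pos_right _ hδ).trans h₁
    -- For `N ≥ 2` the grid thus has at most `N ^ (30 * m)` points, and `30 * m ≤ 15 * (1 + 2 * m)`
    -- explains the exponent 15.
    have hbase : n * δ * n + 1 ≤ N ^ 3 := by
      have := Nat.mul_le_mul h₁ h₂
      nlinarith [Nat.mul_le_mul_right (N * N) h2]
    have hpos : 0 < N := by omega
    rw [← pow_mul]
    set m := min ⌈Real.logb 2 (4 * s)⌉₊ μ with hm
    have hell : ell s μ = 1 + 2 * m := rfl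
    rw [hell]
    have hX : ∀ e, e ≤ (1 + 2 * m) * 15 → N ^ e ≤ 2 ^ 20 * N ^ ((1 + 2 * m) * 15) + 1 := by
      intro e he
      have := Nat.pow_le_pow_right hpos he
      omega
    refine ⟨?_, hbase.trans (hX 3 (by omega))⟩
    calc (n * δ * n + 1) ^ (2 * (5 * m)) ≤ (N ^ 3) ^ (2 * (5 * m)) := Nat.pow_le_pow_left hbase _
      _ = N ^ (3 * (2 * (5 * m))) := (pow_mul _ _ _).symm
      _ ≤ _ := hX _ (by omega)

end HittingSet

end ROABP

theorem mainTheorem4 :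
    ∃ p : Polynomial ℕ, ∀ (F : Type*) [Field F] (K : Type*) [Field K] [Algebra F K]
      (n δ s μ : ℕ),
      ((p.eval ((n * δ * s) ^ ROABP.ell s μ) : ℕ) : ℕ∞) ≤ ENat.card K →
        ∃ H : Finset (Fin n → K),
          H.card ≤ p.eval ((n * δ * s) ^ ROABP.ell s μ) ∧
          ROABP.IsHittingSet (ROABP.polyClass F 2 n δ s μ) (H : Set (Fin n → K)) := by
  -- The summand 1 pays for the single point used when `n * δ * s = 0`.
  refine ⟨Polynomial.C (2 ^ 20) * Polynomial.X ^ 15 + 1, ?_⟩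
  intro F _ K _ _ n δ s μ hcard
  simp only [Polynomial.eval_add, Polynomial.eval_mul, Polynomial.eval_C, Polynomial.eval_pow,
    Polynomial.eval_X, Polynomial.eval_one] at hcard ⊢
  by_cases hN : n * δ * s = 0
  · exact ⟨{0}, by simp, by
      simpa using ROABP.isHittingSet_singleton_of_mul_eq_zero hN⟩
  obtain ⟨hsize, hnodes⟩ := ROABP.hittingSet_size_le μ hN
  obtain ⟨T, hT⟩ := ROABP.exists_finset_card_eq ((Nat.cast_le.mpr hnodes).trans hcard)
  have hn : n ≤ T.card := by
    rw [hT]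
    have := Nat.le_mul_of_pos_left n (Nat.pos_of_ne_zero (left_ne_zero_of_mul hN))
    omega
  obtain ⟨H, hH, hhit⟩ := ROABP.exists_hittingSet_of_le_card (F := F) (δ := δ) (μ := μ)
    (fun i => (T.equivFin.symm (Fin.castLE hn i) : K))
    (Subtype.val_injective.comp (T.equivFin.symm.injective.comp (Fin.castLE_injective hn)))
    (ROABP.le_two_pow_ceil_logb s) T (by omega)
  exact ⟨H, hH.trans (by rwa [hT]), hhit⟩
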